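/- Let $\Sigma_\#=\{0,1,\#\}$. For a sequence $b=b_1b_2b_3\cdots$ of finite binary words $b_i\in\{0,1\}^*$ let $C_\#(b)=\#b_1\#b_2\#b_3\#\cdots\in\Sigma_\#^\omega$, and for a finite binary word $c=c_0c_1\cdots c_m$ let $[c]_2=\sum_i c_i2^i$. Two words in $\Sigma_\#^\omega$ are aligned if the symbol $\#$ occurs at the same positions in both. Let $R\subseteq\Sigma_\#^\omega$ be the set of words of the form $(\#(0|1)^*1(0|1)^*)^\omega$, that is, of the form $C_\#(u)$ where every $u_i$ contains the letter $1$. For $v=C_\#(u)\in R$ put $a_i=[u_i]_2\ge 1$ and let $\alpha(v)=[0;a_1,a_2,\dots]\in(0,1)$ be the irrational number whose continued fraction is coded by $v$. Let $q_{-1}=0$, $q_0=1$, $q_n=a_nq_{n-1}+q_{n-2}$ for $n\ge 1$. An $\alpha(v)$-Ostrowski representation of $N\in\mathbb N$ is a sequence $x_1x_2\cdots$ of natural numbers, eventually $0$, with $N=\sum_{n\ge 0}x_{n+1}q_n$, $x_1<a_1$, $x_n\le a_n$ for all $n\geq 1$, and $x_{n}=0$ whenever $n\ge1$ and $x_{n+1}=a_{n+1}$.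 Let $A_v^{\rm fin}$ be the set of all $w=C_\#(b)\in\Sigma_\#^\omega$ aligned with $v$ such that $[b_1]_2[b_2]_2\cdots$ is an $\alpha(v)$-Ostrowski representation of some natural number; this number is determined by $w$ and is denoted by $Z_v(w)$. **Theorem.** The set $$\oplus^{\rm fin}=\{(v,s_1,s_2,s_3)\ :\ v\in R,\ s_1,s_2,s_3\in A_v^{\rm fin},\ Z_v(s_1)+Z_v(s_2)=Z_v(s_3)\}\subseteq(\Sigma_\#^\omega)^4$$ is $\omega$-regular, that is, there is a Büchi automaton (finitely many states, nondeterministic) over the alphabet $\Sigma_\#^4$ that accepts exactly the words $i\mapsto (v_i,s_{1,i},s_{2,i},s_{3,i})$ with $(v,s_1,s_2,s_3)\in\oplus^{\rm fin}$. -/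

import Mathlib

open Filter Topology

namespace OstrowskiAddition

/-! ### Büchi automata and `ω`-regular sets -/

/-- A Büchi automaton with alphabet `A` and set of states `Q` (`A` and `Q` are required to be finite
in `IsOmegaRegular`): a transition relation, a set of initial states and a set of accept states. -/
structure BuchiAutomaton (A Q : Type) where
  trans : Set (Q × A × Q)
  init : Set Q
  accept : Set Q

/-- `s` is a run of the infinite word `w`, starting at an initial state. -/
def BuchiAutomaton.IsRun {A Q : Type} (M : BuchiAutomaton A Q) (w : ℕ → A) (s : ℕ → Q) : Prop :=
  s 0 ∈ M.init ∧ ∀ n, (s n, w n, s (n + 1)) ∈ M.trans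

/-- The infinite words having a run that visits accept states infinitely often. -/
def BuchiAutomaton.language {A Q : Type} (M : BuchiAutomaton A Q) : Set (ℕ → A) :=
  {w | ∃ s : ℕ → Q, M.IsRun w s ∧ {n | s n ∈ M.accept}.Infinite}

/-- A set of infinite words over a finite alphabet is `ω`-regular if some Büchi automaton
(with finitely many states) recognizes it. -/
def IsOmegaRegular {A : Type} [Finite A] (X : Set (ℕ → A)) : Prop :=
  ∃ (Q : Type) (_ : Finite Q) (M : BuchiAutomaton A Q), M.language = X

/-- The convolution of an `n`-tuple of infinite words over `A`: an infinite word over `Aⁿ`. -/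
def convolution {A : Type} {n : ℕ} (u : Fin n → ℕ → A) : ℕ → (Fin n → A) :=
  fun i j => u j i

/-- A set of `n`-tuples of infinite words is `ω`-regular if the set of convolutions is. -/
def IsOmegaRegularRel {A : Type} [Finite A] {n : ℕ} (X : Set (Fin n → ℕ → A)) : Prop :=
  IsOmegaRegular (convolution '' X)

/-! ### Continued fractions -/

/-- The value of the finite continued fraction `[a 0; a 1, …, a k]`. -/
noncomputable def finiteCF : (ℕ → ℕ) → ℕ → ℝ
  | a, 0 => (a 0 : ℝ)
  | a, k + 1 => (a 0 : ℝ) + 1 / finiteCF (fun i => a (i + 1)) k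

/-- `[0; a 1, a 2, …]` is the (infinite) continued fraction expansion of `α`. -/
def IsCFExpansion (a : ℕ → ℕ) (α : ℝ) : Prop :=
  a 0 = 0 ∧ (∀ i, 0 < i → 0 < a i) ∧ Tendsto (fun k => finiteCF a k) atTop (𝓝 α)

/-- The denominators `q n` of the convergents of `[a 0; a 1, a 2, …]`:
`q 0 = 1`, `q 1 = a 1`, `q (n + 2) = a (n + 2) * q (n + 1) + q n`. -/
def convDenom (a : ℕ → ℕ) : ℕ → ℕ
  | 0 => 1
  | 1 => a 1
  | n + 2 => a (n + 2) * convDenom a (n + 1) + convDenom a n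

/-! ### Ostrowski representations of natural numbers

Sequences whose indices start at `1` on paper are indexed from `0` here: the sequence
`x : ℕ → ℕ` stands for the word `b₁b₂b₃⋯` with `b₍ₙ₊₁₎ = x n`. Partial quotients `a n` and
denominators `q n` keep their usual indices. -/

/-- `x 0, x 1, …` is the `α`-Ostrowski representation of `N` (padded with zeros):
`N = ∑ x n * q n`, with `b₁ < a₁`, `b₍ₙ₊₁₎ ≤ a₍ₙ₊₁₎` and `bₙ = 0` whenever
`b₍ₙ₊₁₎ = a₍ₙ₊₁₎`. -/
def IsOstrowskiRep (α : ℝ) (x : ℕ → ℕ) (N : ℕ) : Prop :=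
  ∃ a : ℕ → ℕ, IsCFExpansion a α ∧
    x 0 < a 1 ∧ (∀ n, x n ≤ a (n + 1)) ∧ (∀ n, x (n + 1) = a (n + 2) → x n = 0) ∧
    ∃ L : ℕ, (∀ n, L < n → x n = 0) ∧ N = ∑ n ∈ Finset.range (L + 1), x n * convDenom a n

/-! ### The `#`-binary coding -/

/-- The alphabet `{0, 1, #}`: `none` is `#`, `some false` is `0`, `some true` is `1`. -/
abbrev HashSym : Type := Option Bool

/-- `[b]₂ = ∑ bᵢ 2ⁱ`, the number with binary representation `b` (least significant bit first). -/
def binVal (b : List Bool) : ℕ := Nat.ofDigits 2 (b.map Bool.toNat)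

/-- The finite word `# b₁ # b₂ ⋯ # bₖ`, where `b i` stands for `b₍ᵢ₊₁₎`. -/
def hashPrefix (b : ℕ → List Bool) (k : ℕ) : List HashSym :=
  (List.range k).flatMap (fun i => none :: (b i).map some)

theorem le_length_hashPrefix (b : ℕ → List Bool) (k : ℕ) : k ≤ (hashPrefix b k).length := by
  induction k with
  | zero => simp
  | succ k ih =>
    have h : hashPrefix b (k + 1) = hashPrefix b k ++ (none :: (b k).map some) := by
      simp [hashPrefix, List.range_succ]
    rw [h, List.length_append, List.length_cons]
    omega

/-- The infinite word `C_#(b) = # b₁ # b₂ # b₃ # ⋯`. Its letter at position `n` is read off from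
the prefix `# b₁ ⋯ # b₍ₙ₊₁₎`, which has at least `n + 1` letters. -/
def hashCode (b : ℕ → List Bool) : ℕ → HashSym :=
  fun n => (hashPrefix b (n + 1))[n]'(le_length_hashPrefix b (n + 1))

/-- Two infinite words are aligned if they have `#` at the same positions. -/
def Aligned (u v : ℕ → HashSym) : Prop := ∀ i, u i = none ↔ v i = none

/-- `v` is a `#`-binary coding of the continued fraction of the irrational number `α ∈ (0, 1)`. -/
def IsHashCoding (v : ℕ → HashSym) (α : ℝ) : Prop :=
  Irrational α ∧ 0 < α ∧ α < 1 ∧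
    ∃ (a : ℕ → ℕ) (u : ℕ → List Bool), IsCFExpansion a α ∧
      (∀ i, binVal (u i) = a (i + 1)) ∧ v = hashCode u

/-- The set `R` of words of the form `(#(0|1)*1(0|1)*)^ω`. -/
def codings : Set (ℕ → HashSym) :=
  {v | ∃ u : ℕ → List Bool, (∀ i, true ∈ u i) ∧ v = hashCode u}

/-- `α(v)` for `v ∈ R`: the irrational number whose continued fraction is coded by `v`.
(For `v ∉ R` the value is arbitrary and never used.) -/
noncomputable def codedReal (v : ℕ → HashSym) : ℝ := Classical.epsilon (fun α => IsHashCoding v α)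

/-- `w` is a `#`-`v`-Ostrowski representation of the natural number `N`. -/
def IsHashOstrowskiRep (v w : ℕ → HashSym) (N : ℕ) : Prop :=
  Aligned v w ∧ ∃ b : ℕ → List Bool,
    w = hashCode b ∧ IsOstrowskiRep (codedReal v) (fun i => binVal (b i)) N

/-- `A_v^fin`: the `#`-`v`-Ostrowski representations of natural numbers. -/
def AFin (v : ℕ → HashSym) : Set (ℕ → HashSym) := {w | ∃ N : ℕ, IsHashOstrowskiRep v w N}

/-- `Z_v : A_v^fin → ℕ` maps `w` to the natural number that it represents. -/
noncomputable def Z (v : ℕ → HashSym) (w : AFin v) : ℕ := Classical.choose w.2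

/-- `⊕^fin`: the tuples `(v, s₁, s₂, s₃)` with `v ∈ R`, `s₁, s₂, s₃ ∈ A_v^fin` and
`Z_v(s₁) + Z_v(s₂) = Z_v(s₃)`. -/
def oplusFin : Set (Fin 4 → ℕ → HashSym) :=
  {t | t 0 ∈ codings ∧ ∃ (h₁ : t 1 ∈ AFin (t 0)) (h₂ : t 2 ∈ AFin (t 0)) (h₃ : t 3 ∈ AFin (t 0)),
    Z (t 0) ⟨t 1, h₁⟩ + Z (t 0) ⟨t 2, h₂⟩ = Z (t 0) ⟨t 3, h₃⟩}

end OstrowskiAddition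

namespace OstrowskiAddition

/-! ### Block codes -/

/-! Let x, y, z be Ostrowski digit sequences for the same partial quotients a, and put d = z - x -
y. Addition holds iff ∑ d_n q_n = 0. Solving r_n = a_{n+1} r_{n+1} + r_{n+2} + d_n downwards from
the point where all digits vanish eliminates the denominators from the top, and the sum equals r_0
(`sum_mul_convDenom`). So addition means that some finitely supported solution r has r_0 = 0.

The automaton needs r to be bounded independently of a. Truncated Ostrowski sums stay below the next
denominator (`OstrowskiDigits.sum_lt`), hence |r_{k+1} q_{k+1} + r_{k+2} q_k| ≤ 2 q_{k+1}, and this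
forces |r_n| ≤ 8 (`abs_le_eight_of_recurrence`).

A finite state can therefore carry (r_n, r_{n+1}) from block to block. For fixed states every
condition on a block is linear in the binary values of its tracks with fixed coefficients, hence
regular (`isRegular_lt_weight`). `isOmegaRegular_blocks` assembles such block conditions into a
Büchi automaton. Uniqueness of blocks and of continued fractions ensures that the chosen objects
`codedReal` and `Z` are the coded ones. -/

/-- The position of the `n`-th separator in the word `# w₀ # w₁ # ⋯`. -/
def blockStart {B : Type} (w : ℕ → List B) (n : ℕ) : ℕ :=
  ∑ i ∈ Finset.range n, ((w i).length + 1)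

theorem blockStart_zero {B : Type} (w : ℕ → List B) : blockStart w 0 = 0 := by
  simp [blockStart]

theorem blockStart_succ {B : Type} (w : ℕ → List B) (n : ℕ) :
    blockStart w (n + 1) = blockStart w n + 1 + (w n).length := by
  simp [blockStart, Finset.sum_range_succ]; ring

/-- `W` is the word `# w₀ # w₁ # ⋯`, with `none` as the separator `#`. -/
structure IsBlockCode {B : Type} (W : ℕ → Option B) (w : ℕ → List B) : Prop where
  hash : ∀ n, W (blockStart w n) = none
  letter : ∀ n i (h : i < (w n).length), W (blockStart w n + 1 + i) = some ((w n)[i])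

theorem exists_eq_blockStart_add {B : Type} (w : ℕ → List B) (k : ℕ) :
    ∃ n i, i ≤ (w n).length ∧ k = blockStart w n + i := by
  induction k with
  | zero => exact ⟨0, 0, by simp, by simp [blockStart_zero]⟩
  | succ k ih =>
    obtain ⟨n, i, hi, rfl⟩ := ih
    rcases hi.lt_or_eq with h | h
    · exact ⟨n, i + 1, h, by ring⟩
    · exact ⟨n + 1, 0, by simp, by rw [blockStart_succ]; omega⟩

theorem blockStart_mono {B : Type} (w : ℕ → List B) : Monotone (blockStart w) :=
  monotone_nat_of_le_succ fun n => by rw [blockStart_succ]; omega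

theorem blockStart_add_inj {B : Type} (w : ℕ → List B) {n m i j : ℕ}
    (hi : i ≤ (w n).length) (hj : j ≤ (w m).length)
    (h : blockStart w n + i = blockStart w m + j) : n = m ∧ i = j := by
  rcases lt_trichotomy n m with hnm | rfl | hnm
  · have := blockStart_mono w (Nat.succ_le_of_lt hnm)
    rw [Nat.succ_eq_add_one, blockStart_succ] at this
    omega
  · exact ⟨rfl, by omega⟩
  · have := blockStart_mono w (Nat.succ_le_of_lt hnm)
    rw [Nat.succ_eq_add_one, blockStart_succ] at this
    omega

theorem IsBlockCode.word_eq {B : Type} {W W' : ℕ → Option B} {w : ℕ → List B}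
    (h : IsBlockCode W w) (h' : IsBlockCode W' w) : W = W' := by
  funext k
  obtain ⟨n, i, hi, rfl⟩ := exists_eq_blockStart_add w k
  rcases i with _ | i
  · rw [add_zero, h.hash, h'.hash]
  · rw [add_comm i, ← add_assoc, h.letter n i hi, h'.letter n i hi]

/-- Otherwise a letter of the longer block would sit on the separator that closes the shorter one.
-/
theorem IsBlockCode.length_le {B : Type} {W : ℕ → Option B} {w w' : ℕ → List B} {n : ℕ}
    (h : IsBlockCode W w) (h' : IsBlockCode W w') (hn : blockStart w n = blockStart w' n) :
    (w n).length ≤ (w' n).length := by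
  by_contra! hlt
  have h1 := h.letter n _ hlt
  have h2 := h'.hash (n + 1)
  rw [blockStart_succ, ← hn, h1] at h2
  exact Option.some_ne_none _ h2

theorem IsBlockCode.blocks_eq {B : Type} {W : ℕ → Option B} {w w' : ℕ → List B}
    (h : IsBlockCode W w) (h' : IsBlockCode W w') : w = w' := by
  have key : ∀ n, blockStart w n = blockStart w' n ∧ w n = w' n := by
    intro n
    have start : blockStart w n = blockStart w' n := by
      induction n with
      | zero => simp [blockStart_zero]
      | succ n ih =>
        rw [blockStart_succ, blockStart_succ,
          le_antisymm (h.length_le h' ih) (h'.length_le h ih.symm), ih]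
    refine ⟨start, List.ext_getElem
      (le_antisymm (h.length_le h' start) (h'.length_le h start.symm)) fun i h1 h2 => ?_⟩
    have e1 := h.letter n i h1
    rw [start, h'.letter n i h2] at e1
    exact (Option.some.inj e1).symm
  exact funext fun n => (key n).2

theorem exists_isBlockCode {B : Type} (w : ℕ → List B) : ∃ W, IsBlockCode W w := by
  choose N I hI hk using exists_eq_blockStart_add w
  have key : ∀ n i, i ≤ (w n).length →
      N (blockStart w n + i) = n ∧ I (blockStart w n + i) = i := fun n i hi => by
    obtain ⟨h1, h2⟩ := blockStart_add_inj w hi (hI _) (hk (blockStart w n + i))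
    exact ⟨h1.symm, h2.symm⟩
  -- Offset `0` is the separator, so the block is indexed with `none` put in front; the default of
  -- `getD` is never reached.
  refine ⟨fun k => (none :: (w (N k)).map some).getD (I k) none, fun n => ?_, fun n i hi => ?_⟩
  · obtain ⟨h1, h2⟩ := key n 0 (by simp)
    rw [add_zero] at h1 h2
    simp only [h1, h2, List.getD_cons_zero]
  · obtain ⟨h1, h2⟩ := key n (i + 1) hi
    rw [add_comm i, ← add_assoc] at h1 h2
    simp only [h1, h2, add_comm 1 i, List.getD_cons_succ]
    simp [List.getD, hi]

theorem exists_blocks {B : Type} {W : ℕ → Option B} (h0 : W 0 = none)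
    (hinf : {k | W k = none}.Infinite) : ∃ w, IsBlockCode W w := by
  set e := Nat.nth (fun k => W k = none) with he
  have e_mono : StrictMono e := Nat.nth_strictMono hinf
  have e_mem : ∀ n, W (e n) = none := Nat.nth_mem_of_infinite hinf
  have e0 : e 0 = 0 := Nat.nth_zero_of_zero h0
  have e_gap : ∀ n i, i < e (n + 1) - e n - 1 → ∃ b, W (e n + 1 + i) = some b := by
    intro n i hi
    rw [← Option.ne_none_iff_exists']
    intro hnone
    obtain ⟨m, hm⟩ : ∃ m, e m = e n + 1 + i := by
      have := Nat.range_nth_of_infinite hinf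
      have h2 : e n + 1 + i ∈ {k | W k = none} := hnone
      rw [← this] at h2
      exact h2
    have h1 : n < m := e_mono.lt_iff_lt.1 (by omega)
    have h2 : m < n + 1 := e_mono.lt_iff_lt.1 (by omega)
    omega
  choose b hb using e_gap
  set w : ℕ → List B := fun n =>
    List.ofFn (fun i : Fin (e (n + 1) - e n - 1) => b n i i.2) with hw
  have hlen : ∀ n, (w n).length = e (n + 1) - e n - 1 := fun n => by simp [hw]
  have hstart : ∀ n, blockStart w n = e n := by
    intro n
    induction n with
    | zero => rw [blockStart_zero, e0]
    | succ n ih =>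
      have := e_mono (Nat.lt_add_one n)
      rw [blockStart_succ, ih, hlen]
      omega
  refine ⟨w, fun n => by rw [hstart, e_mem], fun n i hi => ?_⟩
  rw [hstart, hb n i (by rwa [hlen] at hi)]
  simp [hw]

theorem IsBlockCode.map {B C : Type} {W : ℕ → Option B} {w : ℕ → List B} (f : B → C)
    (h : IsBlockCode W w) :
    IsBlockCode (fun i => (W i).map f) (fun n => (w n).map f) := by
  have hs : blockStart (fun n => (w n).map f) = blockStart w := by
    funext n; simp [blockStart]
  refine ⟨fun n => ?_, fun n i hi => ?_⟩
  · rw [hs, h.hash]; rfl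
  · rw [hs, h.letter n i (by simpa using hi)]; simp

/-! ### The coding `hashCode` as a block code -/

theorem hashPrefix_succ (b : ℕ → List Bool) (n : ℕ) :
    hashPrefix b (n + 1) = hashPrefix b n ++ (none :: (b n).map some) := by
  simp [hashPrefix, List.range_succ]

theorem length_hashPrefix (b : ℕ → List Bool) (n : ℕ) :
    (hashPrefix b n).length = blockStart b n := by
  induction n with
  | zero => simp [hashPrefix, blockStart]
  | succ n ih => rw [hashPrefix_succ, List.length_append, ih, blockStart_succ]; simp; ring

theorem hashPrefix_prefix (b : ℕ → List Bool) {m n : ℕ} (h : m ≤ n) :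
    hashPrefix b m <+: hashPrefix b n := by
  induction n, h using Nat.le_induction with
  | base => exact List.prefix_refl _
  | succ n _ ih => exact ih.trans (by rw [hashPrefix_succ]; exact List.prefix_append _ _)

theorem hashCode_eq_getElem (b : ℕ → List Bool) (m k : ℕ) (h : k < (hashPrefix b m).length) :
    hashCode b k = (hashPrefix b m)[k] := by
  rcases le_total m (k + 1) with hm | hm
  · exact ((hashPrefix_prefix b hm).getElem h).symm
  · exact (hashPrefix_prefix b hm).getElem _

theorem isBlockCode_hashCode (b : ℕ → List Bool) : IsBlockCode (hashCode b) b := by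
  refine ⟨fun n => ?_, fun n i hi => ?_⟩
  · rw [hashCode_eq_getElem b (n + 1) _ (by rw [length_hashPrefix, blockStart_succ]; omega)]
    simp [hashPrefix_succ, ← length_hashPrefix]
  · rw [hashCode_eq_getElem b (n + 1) _ (by rw [length_hashPrefix, blockStart_succ]; omega)]
    simp only [hashPrefix_succ, ← length_hashPrefix, add_assoc]
    rw [List.getElem_append_right (by omega)]
    simp [add_comm 1 i]

theorem IsBlockCode.eq_hashCode {v : ℕ → HashSym} {b : ℕ → List Bool} (h : IsBlockCode v b) :
    v = hashCode b :=
  h.word_eq (isBlockCode_hashCode b)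

theorem hashCode_injective : Function.Injective hashCode := fun b b' h =>
  (isBlockCode_hashCode b).blocks_eq (h ▸ isBlockCode_hashCode b')

/-- Alignment is equality after all letters are identified (mapped to `()`), and a block code
determines its blocks. -/
theorem Aligned.length_eq {b b' : ℕ → List Bool} (h : Aligned (hashCode b) (hashCode b'))
    (n : ℕ) : (b n).length = (b' n).length := by
  have key := (isBlockCode_hashCode b).map (fun _ => ())
  have key' := (isBlockCode_hashCode b').map (fun _ => ())
  have : (fun i => (hashCode b i).map fun _ => ()) =
      fun i => (hashCode b' i).map fun _ => () := by
    funext i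
    have := h i
    rcases h1 : hashCode b i with _ | x <;> rcases h2 : hashCode b' i with _ | y <;>
      simp_all
  rw [this] at key
  simpa using congrArg List.length (congrFun (key.blocks_eq key') n)

theorem Aligned.of_length_eq {b b' : ℕ → List Bool} (h : ∀ n, (b n).length = (b' n).length) :
    Aligned (hashCode b) (hashCode b') := by
  have key := (isBlockCode_hashCode b).map (fun _ => ())
  have key' := (isBlockCode_hashCode b').map (fun _ => ())
  have hb : (fun n => (b n).map fun _ => ()) = fun n => (b' n).map fun _ => () := by
    funext n
    simp [h n]
  rw [hb] at key
  intro i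
  simpa using congrArg (· = none) (congrFun (key.word_eq key') i)

/-! ### From regular block conditions to Büchi automata -/

/-- The product of the individual automata. One deterministic machine must serve all pairs of
states, because the guess of the next state is made only at the closing separator. -/
theorem exists_common_automaton {B ι : Type} [Finite ι] {T : ι → Language B}
    (hT : ∀ i, (T i).IsRegular) :
    ∃ (D : Type) (_ : Finite D) (step : D → B → D) (d₀ : D) (acc : ι → Set D),
      ∀ i w, w ∈ T i ↔ w.foldl step d₀ ∈ acc i := by
  choose σ hσ M hM using hT
  refine ⟨∀ i, σ i, inferInstance, fun d b i => (M i).step (d i) b, fun i => (M i).start,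
    fun i => {d | d i ∈ (M i).accept}, fun i w => ?_⟩
  have key : ∀ (w : List B) (d : ∀ i, σ i),
      (w.foldl (fun d b i => (M i).step (d i) b) d) i = (M i).evalFrom (d i) w := by
    intro w
    induction w with
    | nil => intro d; rfl
    | cons b w ih => intro d; rw [List.foldl_cons, ih]; rfl
  rw [← hM i, DFA.mem_accepts, DFA.eval, ← key w (fun i => (M i).start)]
  rfl

/-- The Büchi automaton that guesses, at every separator, the state in `P` reached after the
next block, and runs the automaton `(D, step, d₀)` inside the blocks. -/
def blockAutomaton {B P D : Type} (step : D → B → D) (d₀ : D) (acc : P × P → Set D)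
    (I F : Set P) : BuchiAutomaton (Option B) (Option (P × D × Bool)) where
  trans := {x | (x.1 = none ∧ x.2.1 = none ∧ ∃ p ∈ I, x.2.2 = some (p, d₀, true)) ∨
    (∃ p d f p', x.1 = some (p, d, f) ∧ x.2.1 = none ∧ d ∈ acc (p, p') ∧
      x.2.2 = some (p', d₀, true)) ∨
    (∃ p d f b, x.1 = some (p, d, f) ∧ x.2.1 = some b ∧ x.2.2 = some (p, step d b, false))}
  init := {none}
  -- The Boolean is `true` just after a separator. Requiring it here rejects words with finitely
  -- many separators, whose last block would otherwise keep an accepting `p` forever.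
  accept := {x | ∃ p ∈ F, ∃ d, x = some (p, d, true)}

theorem blockAutomaton_complete {B P D : Type} (step : D → B → D) (d₀ : D)
    (acc : P × P → Set D) (I F : Set P) {W : ℕ → Option B} {w : ℕ → List B}
    (hW : IsBlockCode W w) {p : ℕ → P} (h0 : p 0 ∈ I)
    (hp : ∀ n, (w n).foldl step d₀ ∈ acc (p n, p (n + 1))) (hF : {n | p n ∈ F}.Infinite) :
    W ∈ (blockAutomaton step d₀ acc I F).language := by
  choose N J hJ hk using exists_eq_blockStart_add w
  have key : ∀ n i, i ≤ (w n).length →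
      N (blockStart w n + i) = n ∧ J (blockStart w n + i) = i := fun n i hi => by
    obtain ⟨h1, h2⟩ := blockStart_add_inj w hi (hJ _) (hk (blockStart w n + i))
    exact ⟨h1.symm, h2.symm⟩
  -- `s (k + 1)` is the state after reading position `k`, which has offset `J k` in block `N k`; by
  -- then `J k` letters of that block are read.
  set s : ℕ → Option (P × D × Bool) := fun k => match k with
    | 0 => none
    | k + 1 => some (p (N k), ((w (N k)).take (J k)).foldl step d₀, decide (J k = 0)) with hs
  have hs0 : s 0 = none := rfl
  have hs1 : ∀ n i, i ≤ (w n).length → s (blockStart w n + i + 1) =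
      some (p n, ((w n).take i).foldl step d₀, decide (i = 0)) := by
    intro n i hi
    obtain ⟨h1, h2⟩ := key n i hi
    simp only [hs, h1, h2]
  refine ⟨s, ⟨hs0, fun k => ?_⟩, ?_⟩
  · obtain ⟨n, i, hi, rfl⟩ := exists_eq_blockStart_add w k
    rcases i with _ | i
    · have e2 := hs1 n 0 (by simp)
      simp only [add_zero, List.take_zero, List.foldl_nil, decide_true] at e2 ⊢
      rw [e2, hW.hash]
      rcases n with _ | n
      · rw [blockStart_zero, hs0]
        exact Or.inl ⟨rfl, rfl, p 0, h0, rfl⟩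
      · rw [blockStart_succ, add_right_comm, hs1 n _ le_rfl, List.take_length]
        exact Or.inr (Or.inl ⟨_, _, _, _, rfl, rfl, hp n, rfl⟩)
    · rw [hs1 n _ hi, ← add_assoc, hs1 n i (by omega), add_right_comm, hW.letter n i hi]
      refine Or.inr (Or.inr ⟨_, _, _, _, rfl, rfl, ?_⟩)
      rw [List.take_succ_eq_append_getElem hi, List.foldl_append]
      rfl
  · have hinj : Function.Injective fun n => blockStart w n + 1 := by
      intro n m h
      exact (blockStart_add_inj w (i := 0) (j := 0) (by simp) (by simp)
        (by simpa using h)).1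
    refine (hF.image hinj.injOn).mono ?_
    rintro _ ⟨n, hn, rfl⟩
    exact ⟨p n, hn, d₀, by simpa using hs1 n 0 (by simp)⟩

theorem blockAutomaton_sound {B P D : Type} (step : D → B → D) (d₀ : D)
    (acc : P × P → Set D) (I F : Set P) {W : ℕ → Option B}
    (hW : W ∈ (blockAutomaton step d₀ acc I F).language) :
    ∃ (w : ℕ → List B) (p : ℕ → P), IsBlockCode W w ∧ p 0 ∈ I ∧
      (∀ n, (w n).foldl step d₀ ∈ acc (p n, p (n + 1))) ∧ {n | p n ∈ F}.Infinite := by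
  obtain ⟨s, ⟨hinit, htrans⟩, hacc⟩ := hW
  replace hinit : s 0 = none := hinit
  have hash_of : ∀ k p d, s (k + 1) = some (p, d, true) → W k = none := by
    intro k p d hk
    rcases htrans k with ⟨_, h, _⟩ | ⟨_, _, _, _, _, h, _⟩ | ⟨_, _, _, _, _, _, h⟩
    · exact h
    · exact h
    · simp [hk] at h
  have h0 : W 0 = none ∧ ∃ p ∈ I, s 1 = some (p, d₀, true) := by
    rcases htrans 0 with ⟨_, h, h'⟩ | ⟨_, _, _, _, h, _⟩ | ⟨_, _, _, _, h, _⟩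
    · exact ⟨h, h'⟩
    · simp [hinit] at h
    · simp [hinit] at h
  have hpos : ∀ k ∈ {n | s n ∈ (blockAutomaton step d₀ acc I F).accept},
      ∃ j p, p ∈ F ∧ k = j + 1 ∧ W j = none ∧ ∃ d, s (j + 1) = some (p, d, true) := by
    rintro k ⟨p, hp, d, hd⟩
    rcases k with _ | k
    · simp [hinit] at hd
    · exact ⟨k, p, hp, rfl, hash_of _ _ _ hd, d, hd⟩
  -- Each accepting visit comes right after a separator.
  have hinf : {k | W k = none}.Infinite := by
    intro hfin
    refine hacc ((hfin.image (· + 1)).subset ?_)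
    intro k hk
    obtain ⟨j, p, _, rfl, hj, _⟩ := hpos k hk
    exact ⟨j, hj, rfl⟩
  obtain ⟨w, hw⟩ := exists_blocks h0.1 hinf
  have hfresh : ∀ n, ∃ p, s (blockStart w n + 1) = some (p, d₀, true) := by
    intro n
    rcases htrans (blockStart w n) with ⟨_, _, p, _, h⟩ | ⟨_, _, _, p, _, _, _, h⟩ |
      ⟨_, _, _, _, _, h, _⟩
    · exact ⟨p, h⟩
    · exact ⟨p, h⟩
    · simp [hw.hash] at h
  choose p hp using hfresh
  have hrun : ∀ n i, i ≤ (w n).length → ∃ f, s (blockStart w n + 1 + i) =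
      some (p n, ((w n).take i).foldl step d₀, f) := by
    intro n i
    induction i with
    | zero => intro _; exact ⟨true, by simpa using hp n⟩
    | succ i ih =>
      intro hi
      obtain ⟨f, hf⟩ := ih (by omega)
      rcases htrans (blockStart w n + 1 + i) with ⟨h, _⟩ | ⟨_, _, _, _, _, h, _⟩ |
        ⟨p', d', f', b, h1, h2, h3⟩
      · simp [hf] at h
      · simp [hw.letter n i hi] at h
      · simp only [hw.letter n i hi, Option.some.injEq] at h2
        simp only [hf, Option.some.injEq, Prod.mk.injEq] at h1
        refine ⟨false, ?_⟩
        replace h3 : s (blockStart w n + 1 + i + 1) = _ := h3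
        rw [← add_assoc, h3, List.take_succ_eq_append_getElem hi, List.foldl_append, h1.1, h2,
          ← h1.2.1]
        rfl
  refine ⟨w, p, hw, ?_, fun n => ?_, ?_⟩
  · obtain ⟨_, q, hq, h⟩ := h0
    have := hp 0
    rw [blockStart_zero, zero_add, h] at this
    simp only [Option.some.injEq, Prod.mk.injEq] at this
    exact this.1 ▸ hq
  · obtain ⟨f, hf⟩ := hrun n _ le_rfl
    rw [List.take_length, ← blockStart_succ] at hf
    rcases htrans (blockStart w (n + 1)) with ⟨h, _⟩ | ⟨q, d, _, q', h1, _, h2, h3⟩ |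
      ⟨_, _, _, _, _, h, _⟩
    · simp [hf] at h
    · simp only [hf, Option.some.injEq, Prod.mk.injEq] at h1
      simp only [hp (n + 1), Option.some.injEq, Prod.mk.injEq] at h3
      rw [h1.1, h1.2.1, h3.1]
      exact h2
    · simp [hw.hash] at h
  · intro hfin
    refine hacc ((hfin.image fun n => blockStart w n + 1).subset ?_)
    intro k hk
    obtain ⟨j, q, hq, rfl, hj, d, hd⟩ := hpos k hk
    obtain ⟨n, i, hi, rfl⟩ := exists_eq_blockStart_add w j
    rcases i with _ | i
    · refine ⟨n, ?_, rfl⟩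
      have := hp n
      rw [add_zero] at hd
      simp only [hd, Option.some.injEq, Prod.mk.injEq] at this
      change p n ∈ F
      rw [← this.1]
      exact hq
    · rw [add_comm i, ← add_assoc, hw.letter n i hi] at hj
      simp at hj

/-- Reduces ω-regularity to finite words: regular conditions between consecutive blocks, linked by
finitely many states. -/
theorem isOmegaRegular_blocks {B P : Type} [Finite B] [Finite P] (T : P → P → Language B)
    (hT : ∀ p p', (T p p').IsRegular) (I F : Set P) :
    IsOmegaRegular {W : ℕ → Option B | ∃ (w : ℕ → List B) (p : ℕ → P), IsBlockCode W w ∧ p 0 ∈ I ∧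
      (∀ n, w n ∈ T (p n) (p (n + 1))) ∧ {n | p n ∈ F}.Infinite} := by
  obtain ⟨D, _, step, d₀, acc, hacc⟩ :=
    exists_common_automaton (T := fun i : P × P => T i.1 i.2) fun i => hT i.1 i.2
  refine ⟨_, inferInstance, blockAutomaton step d₀ acc I F, Set.ext fun W => ⟨fun h => ?_, ?_⟩⟩
  · obtain ⟨w, p, h1, h2, h3, h4⟩ := blockAutomaton_sound step d₀ acc I F h
    exact ⟨w, p, h1, h2, fun n => (hacc (p n, p (n + 1)) _).2 (h3 n), h4⟩
  · rintro ⟨w, p, h1, h2, h3, h4⟩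
    exact blockAutomaton_complete step d₀ acc I F h1 h2
      (fun n => (hacc (p n, p (n + 1)) _).1 (h3 n)) h4

/-- The new automaton guesses a preimage of each letter. -/
theorem IsOmegaRegular.image {A A' : Type} [Finite A] [Finite A'] {X : Set (ℕ → A)}
    (h : IsOmegaRegular X) (f : A → A') :
    IsOmegaRegular ((fun W i => f (W i)) '' X) := by
  obtain ⟨Q, hQ, M, rfl⟩ := h
  refine ⟨Q, hQ, ⟨{x | ∃ c, x.2.1 = f c ∧ (x.1, c, x.2.2) ∈ M.trans}, M.init, M.accept⟩,
    Set.ext fun W => ⟨?_, ?_⟩⟩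
  · rintro ⟨s, ⟨h0, hs⟩, hacc⟩
    choose c hc hs using hs
    exact ⟨c, ⟨s, ⟨h0, hs⟩, hacc⟩, funext fun i => (hc i).symm⟩
  · rintro ⟨c, ⟨s, ⟨h0, hs⟩, hacc⟩, rfl⟩
    exact ⟨s, ⟨h0, fun n => ⟨c n, rfl, hs n⟩⟩, hacc⟩

end OstrowskiAddition

namespace OstrowskiAddition

/-! ### Regularity of linear conditions on numbers given by their binary digits -/

/-- `∑ e(wⱼ) 2ʲ`, for integer weights `e` of the letters. -/
def weight {B : Type} (e : B → ℤ) : List B → ℤ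
  | [] => 0
  | b :: w => e b + 2 * weight e w

theorem weight_append {B : Type} (e : B → ℤ) (u w : List B) :
    weight e (u ++ w) = weight e u + 2 ^ u.length * weight e w := by
  induction u with
  | nil => simp [weight]
  | cons b u ih => simp [weight, ih, pow_succ]; ring

theorem abs_weight_le {B : Type} (e : B → ℤ) {E : ℤ} (hE : ∀ b, |e b| ≤ E) (w : List B) :
    |weight e w| ≤ E * (2 ^ w.length - 1) := by
  induction w with
  | nil => simp [weight]
  | cons b w ih =>
    have h := hE b
    rw [abs_le] at ih h ⊢
    simp only [weight, List.length_cons, pow_succ]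
    constructor <;> nlinarith

theorem weight_add {B : Type} (e e' : B → ℤ) (w : List B) :
    weight (fun b => e b + e' b) w = weight e w + weight e' w := by
  induction w with
  | nil => rfl
  | cons b w ih => simp only [weight, ih]; ring

theorem weight_sub {B : Type} (e e' : B → ℤ) (w : List B) :
    weight (fun b => e b - e' b) w = weight e w - weight e' w := by
  induction w with
  | nil => rfl
  | cons b w ih => simp only [weight, ih]; ring

theorem weight_mul {B : Type} (c : ℤ) (e : B → ℤ) (w : List B) :
    weight (fun b => c * e b) w = c * weight e w := by
  induction w with
  | nil => simp [weight]
  | cons b w ih => simp only [weight, ih]; ring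

theorem weight_map_toNat {B : Type} (f : B → Bool) (w : List B) :
    weight (fun b => ((f b).toNat : ℤ)) w = binVal (w.map f) := by
  induction w with
  | nil => simp [weight, binVal]
  | cons b w ih =>
    simp only [weight, ih, binVal, List.map_cons, Nat.ofDigits_cons]
    push_cast
    ring

/-- Myhill–Nerode: after reading `u`, the condition on the rest is again a threshold, `⌊(k - weight
e u) / 2 ^ |u|⌋ < weight e w`. As `weight e u` is at most of order `2 ^ |u|`, only finitely many
thresholds occur. -/
theorem isRegular_lt_weight {B : Type} [Finite B] (e : B → ℤ) (k : ℤ) :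
    Language.IsRegular {w : List B | k < weight e w} := by
  obtain ⟨E, hE⟩ : ∃ E : ℤ, ∀ b, |e b| ≤ E := by
    obtain ⟨E, hE⟩ := (Set.finite_range fun b => |e b|).bddAbove
    exact ⟨E, fun b => hE ⟨b, rfl⟩⟩
  refine Language.IsRegular.of_finite_range_leftQuotient
    (((Set.finite_Icc (-(|k| + |E| + 1)) (|k| + |E| + 1)).image
      fun m : ℤ => ({w : List B | m < weight e w} : Language B)).subset ?_)
  rintro _ ⟨u, rfl⟩
  have hpos : (0 : ℤ) < 2 ^ u.length := by positivity
  refine ⟨(k - weight e u) / 2 ^ u.length, ?_, ?_⟩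
  · have h1 := abs_weight_le e hE u
    have h2 : (1 : ℤ) ≤ 2 ^ u.length := Int.add_one_le_iff.2 hpos
    have h3 : E * (2 ^ u.length - 1) ≤ |E| * (2 ^ u.length - 1) :=
      mul_le_mul_of_nonneg_right (le_abs_self E) (by linarith)
    have h4 : |k| ≤ |k| * 2 ^ u.length := le_mul_of_one_le_right (abs_nonneg k) h2
    have h5 := abs_nonneg E
    rw [abs_le] at h1
    have h6 := neg_abs_le k
    have h7 := le_abs_self k
    constructor
    · rw [Int.le_ediv_iff_mul_le hpos]
      nlinarith
    · refine Int.ediv_le_of_le_mul hpos ?_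
      nlinarith
  · ext w
    change (k - weight e u) / 2 ^ u.length < weight e w ↔ k < weight e (u ++ w)
    rw [weight_append, Int.ediv_lt_iff_lt_mul hpos, sub_lt_iff_lt_add', mul_comm]

/-! ### Boolean combinations of regular conditions -/

theorem isRegular_univ {B : Type} : Language.IsRegular (Set.univ : Set (List B)) :=
  ⟨Unit, inferInstance, ⟨fun _ _ => (), (), Set.univ⟩, by ext; simp [DFA.mem_accepts]; trivial⟩

theorem isRegular_and {B : Type} {p q : List B → Prop}
    (hp : Language.IsRegular {w | p w}) (hq : Language.IsRegular {w | q w}) :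
    Language.IsRegular {w | p w ∧ q w} :=
  hp.inf hq

theorem isRegular_not {B : Type} {p : List B → Prop} (hp : Language.IsRegular {w | p w}) :
    Language.IsRegular {w | ¬ p w} :=
  hp.compl

theorem isRegular_imp {B : Type} {p q : List B → Prop}
    (hp : Language.IsRegular {w | p w}) (hq : Language.IsRegular {w | q w}) :
    Language.IsRegular {w | p w → q w} := by
  have h : {w | p w → q w} = {w | ¬ (p w ∧ ¬ q w)} := by ext w; simp
  exact h ▸ isRegular_not (isRegular_and hp (isRegular_not hq))

theorem isRegular_const {B : Type} (p : Prop) : Language.IsRegular {_w : List B | p} := by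
  by_cases h : p
  · simpa [h] using isRegular_univ (B := B)
  · simpa [h] using isRegular_not (p := fun _ : List B => True) (by simpa using isRegular_univ)

theorem isRegular_forall {B : Type} {n : ℕ} {p : Fin n → List B → Prop}
    (hp : ∀ j, Language.IsRegular {w | p j w}) : Language.IsRegular {w | ∀ j, p j w} := by
  induction n with
  | zero => simpa using isRegular_univ (B := B)
  | succ n ih =>
    simp only [Fin.forall_fin_succ]
    exact isRegular_and (hp 0) (ih fun j => hp j.succ)

theorem isRegular_weight_eq {B : Type} [Finite B] (e : B → ℤ) (k : ℤ) :
    Language.IsRegular {w : List B | weight e w = k} := by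
  have h : {w : List B | weight e w = k} = {w | k - 1 < weight e w ∧ ¬ k < weight e w} := by
    ext w
    change weight e w = k ↔ k - 1 < weight e w ∧ ¬ k < weight e w
    omega
  exact h ▸ isRegular_and (isRegular_lt_weight e _) (isRegular_not (isRegular_lt_weight e _))

end OstrowskiAddition

namespace OstrowskiAddition

/-! ### Infinite continued fractions -/

theorem finiteCF_pos {a : ℕ → ℕ} (ha : ∀ i, 0 < a i) (k : ℕ) : 1 ≤ finiteCF a k := by
  induction k generalizing a with
  | zero => simpa [finiteCF] using Nat.succ_le_of_lt (ha 0)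
  | succ k ih =>
    have h1 := ih (a := fun i => a (i + 1)) fun i => ha _
    have h2 : (1 : ℝ) ≤ a 0 := by exact_mod_cast ha 0
    rw [finiteCF]
    have : 0 ≤ 1 / finiteCF (fun i => a (i + 1)) k := by positivity
    linarith

/-- Two continued fraction steps contract by 1/4, since both factors of the common denominator are
at least 2. -/
theorem abs_one_div_sub_one_div_le {c x y : ℝ} (hc : 1 ≤ c) (hx : 1 ≤ x) (hy : 1 ≤ y) :
    |1 / (c + 1 / x) - 1 / (c + 1 / y)| ≤ |x - y| / 4 := by
  have h1 : 0 < c * x + 1 := by positivity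
  have h2 : 0 < c * y + 1 := by positivity
  have e : 1 / (c + 1 / x) - 1 / (c + 1 / y) = (x - y) / ((c * x + 1) * (c * y + 1)) := by
    field_simp
    ring
  rw [e, abs_div, abs_of_pos (by positivity : 0 < (c * x + 1) * (c * y + 1))]
  refine div_le_div_of_nonneg_left (abs_nonneg _) (by norm_num) ?_
  have h3 : 2 ≤ c * x + 1 := by nlinarith
  have h4 : 2 ≤ c * y + 1 := by nlinarith
  nlinarith

theorem abs_finiteCF_sub_le {a : ℕ → ℕ} (ha : ∀ i, 0 < a i) (n i j : ℕ) :
    |finiteCF a (2 * n + 1 + i) - finiteCF a (2 * n + 1 + j)| ≤ (1 / 4) ^ n := by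
  induction n generalizing a with
  | zero =>
    have h : ∀ k, finiteCF a (2 * 0 + 1 + k) - a 0 ∈ Set.Icc (0 : ℝ) 1 := by
      intro k
      rw [show 2 * 0 + 1 + k = k + 1 by ring, finiteCF, add_sub_cancel_left]
      have := finiteCF_pos (a := fun i => a (i + 1)) (fun i => ha _) k
      exact ⟨by positivity, (div_le_one (by positivity)).2 this⟩
    obtain ⟨h1, h2⟩ := h i
    obtain ⟨h3, h4⟩ := h j
    rw [abs_le]
    constructor <;> simp <;> linarith
  | succ n ih =>
    have h := ih (a := fun i => a (i + 2)) fun i => ha _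
    have e : ∀ k, finiteCF a (2 * (n + 1) + 1 + k) =
        a 0 + 1 / (a 1 + 1 / finiteCF (fun i => a (i + 2)) (2 * n + 1 + k)) := by
      intro k
      rw [show 2 * (n + 1) + 1 + k = (2 * n + 1 + k) + 1 + 1 by ring, finiteCF, finiteCF]
    rw [e, e, add_sub_add_left_eq_sub]
    refine (abs_one_div_sub_one_div_le (by exact_mod_cast ha 1)
      (finiteCF_pos (fun i => ha _) _) (finiteCF_pos (fun i => ha _) _)).trans ?_
    rw [pow_succ]
    linarith

theorem exists_tendsto_finiteCF {a : ℕ → ℕ} (ha : ∀ i, 0 < a i) :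
    ∃ β : ℝ, Tendsto (finiteCF a) atTop (𝓝 β) := by
  refine cauchySeq_tendsto_of_complete (Metric.cauchySeq_iff'.2 fun ε hε => ?_)
  obtain ⟨n, hn⟩ := exists_pow_lt_of_lt_one hε (by norm_num : (1 / 4 : ℝ) < 1)
  refine ⟨2 * n + 1, fun k hk => ?_⟩
  obtain ⟨i, rfl⟩ := Nat.exists_eq_add_of_le hk
  exact (abs_finiteCF_sub_le ha n i 0).trans_lt hn

/-- `β = [a 0; a 1, a 2, …]` with all partial quotients positive. -/
def IsPosCF (a : ℕ → ℕ) (β : ℝ) : Prop :=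
  (∀ i, 0 < a i) ∧ Tendsto (finiteCF a) atTop (𝓝 β)

theorem tendsto_finiteCF_cons {a : ℕ → ℕ} {β : ℝ} (h : IsPosCF (fun i => a (i + 1)) β) :
    Tendsto (finiteCF a) atTop (𝓝 (a 0 + 1 / β)) := by
  have hβ : 1 ≤ β := ge_of_tendsto' h.2 fun k => finiteCF_pos h.1 k
  rw [← tendsto_add_atTop_iff_nat 1]
  exact tendsto_const_nhds.add (tendsto_const_nhds.div h.2 (by positivity))

theorem IsPosCF.exists_tail {a : ℕ → ℕ} {β : ℝ} (h : IsPosCF a β) :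
    ∃ γ, IsPosCF (fun i => a (i + 1)) γ ∧ β = a 0 + 1 / γ := by
  obtain ⟨γ, hγ⟩ := exists_tendsto_finiteCF (a := fun i => a (i + 1)) fun i => h.1 _
  exact ⟨γ, ⟨fun i => h.1 _, hγ⟩,
    tendsto_nhds_unique h.2 (tendsto_finiteCF_cons ⟨fun i => h.1 _, hγ⟩)⟩

theorem IsPosCF.one_lt {a : ℕ → ℕ} {β : ℝ} (h : IsPosCF a β) : 1 < β := by
  obtain ⟨γ, hγ, rfl⟩ := h.exists_tail
  have h1 : 1 ≤ γ := ge_of_tendsto' hγ.2 fun k => finiteCF_pos hγ.1 k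
  have h2 : (1 : ℝ) ≤ a 0 := by exact_mod_cast h.1 0
  have : 0 < 1 / γ := by positivity
  linarith

/-- The tail exceeds 1, so `⌊β⌋₊` is the first partial quotient; this determines the tail, and the
argument repeats. -/
theorem IsPosCF.partialQuotient_eq {a a' : ℕ → ℕ} {β : ℝ} (h : IsPosCF a β)
    (h' : IsPosCF a' β) (n : ℕ) : a n = a' n := by
  have key : ∀ {a : ℕ → ℕ} {β : ℝ} (h : IsPosCF a β), ∃ γ,
      IsPosCF (fun i => a (i + 1)) γ ∧ β = a 0 + 1 / γ ∧ ⌊β⌋₊ = a 0 := by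
    intro a β h
    obtain ⟨γ, hγ, rfl⟩ := h.exists_tail
    have h1 := hγ.one_lt
    refine ⟨γ, hγ, rfl, ?_⟩
    have h2 : 1 / γ < 1 := (div_lt_one (by linarith)).2 h1
    have h3 : 0 < 1 / γ := by positivity
    rw [Nat.floor_eq_iff (by positivity)]
    constructor <;> linarith
  obtain ⟨γ, hγ, e, f⟩ := key h
  obtain ⟨γ', hγ', e', f'⟩ := key h'
  induction n generalizing a a' β γ γ' with
  | zero => rw [← f, f']
  | succ n ih =>
    have e2 : γ = γ' := by
      rw [e, ← f, f'] at e'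
      simpa using e'
    subst e2
    obtain ⟨δ, hδ, k1, k2⟩ := key hγ
    obtain ⟨δ', hδ', k1', k2'⟩ := key hγ'
    exact ih hγ hγ' δ hδ k1 k2 δ' hδ' k1' k2'

/-- Euclidean descent: if `β = p / q`, the tail is `q / (p - a 0 * q)`, with a smaller positive
denominator. -/
theorem IsPosCF.irrational {a : ℕ → ℕ} {β : ℝ} (h : IsPosCF a β) : Irrational β := by
  have key : ∀ (q : ℕ) (p : ℕ) (a : ℕ → ℕ) (β : ℝ), IsPosCF a β → 0 < q → β ≠ p / q := by
    intro q
    induction q using Nat.strong_induction_on with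
    | _ q ih =>
      intro p a β h hq e
      obtain ⟨γ, hγ, hβ⟩ := h.exists_tail
      have h1 := hγ.one_lt
      have hq' : (0 : ℝ) < q := by exact_mod_cast hq
      have hr : (p - a 0 * q : ℝ) = q / γ := by
        have : (p : ℝ) = β * q := by rw [e]; field_simp
        rw [this, hβ]
        ring
      have hpos : (0 : ℝ) < p - a 0 * q := by rw [hr]; positivity
      have hlt : (p - a 0 * q : ℝ) < q := by rw [hr]; exact div_lt_self hq' h1
      have hle : a 0 * q ≤ p := by
        have : ((a 0 * q : ℕ) : ℝ) < p := by push_cast; linarith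
        exact_mod_cast this.le
      have hcast : ((p - a 0 * q : ℕ) : ℝ) = p - a 0 * q := by push_cast [hle]; ring
      refine ih (p - a 0 * q) ?_ q _ γ hγ ?_ ?_
      · have : ((p - a 0 * q : ℕ) : ℝ) < q := by rw [hcast]; exact hlt
        exact_mod_cast this
      · have : (0 : ℝ) < ((p - a 0 * q : ℕ) : ℝ) := by rw [hcast]; exact hpos
        exact_mod_cast this
      · rw [hcast, hr]
        field_simp
  rintro ⟨x, hx⟩
  have hxpos : 0 < x := by
    have : (0 : ℝ) < x := by rw [hx]; linarith [h.one_lt]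
    exact_mod_cast this
  refine key x.den x.num.toNat a β h x.den_pos ?_
  have hn : ((x.num.toNat : ℕ) : ℝ) = x.num := by
    exact_mod_cast Int.toNat_of_nonneg (Rat.num_pos.2 hxpos).le
  rw [hn, ← hx]
  exact_mod_cast (Rat.num_div_den x).symm

theorem IsCFExpansion.exists_isPosCF {a : ℕ → ℕ} {α : ℝ} (h : IsCFExpansion a α) :
    ∃ β, IsPosCF (fun i => a (i + 1)) β ∧ α = 1 / β := by
  obtain ⟨β, hβ⟩ := exists_tendsto_finiteCF (a := fun i => a (i + 1)) fun i => h.2.1 _ (by omega)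
  have hp : IsPosCF (fun i => a (i + 1)) β := ⟨fun i => h.2.1 _ (by omega), hβ⟩
  refine ⟨β, hp, tendsto_nhds_unique h.2.2 ?_⟩
  simpa [h.1] using tendsto_finiteCF_cons hp

theorem IsCFExpansion.unique {a a' : ℕ → ℕ} {α : ℝ} (h : IsCFExpansion a α)
    (h' : IsCFExpansion a' α) : a = a' := by
  obtain ⟨β, hβ, e⟩ := h.exists_isPosCF
  obtain ⟨β', hβ', e'⟩ := h'.exists_isPosCF
  have hββ : β = β' := by simpa [e] using e'
  subst hββ
  funext n
  rcases n with _ | n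
  · rw [h.1, h'.1]
  · exact hβ.partialQuotient_eq hβ' n

/-- The partial quotients `0, [u₀]₂, [u₁]₂, …` coded by `# u₀ # u₁ # ⋯`. -/
def codedQuotients (u : ℕ → List Bool) : ℕ → ℕ
  | 0 => 0
  | n + 1 => binVal (u n)

theorem exists_isHashCoding {u : ℕ → List Bool} (hu : ∀ n, 0 < binVal (u n)) :
    ∃ α, IsHashCoding (hashCode u) α := by
  obtain ⟨β, hβ⟩ := exists_tendsto_finiteCF hu
  have hp : IsPosCF (fun i => codedQuotients u (i + 1)) β := ⟨hu, hβ⟩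
  have h1 := hp.one_lt
  refine ⟨1 / β, ?_, by positivity, (div_lt_one (by positivity)).2 h1, codedQuotients u, u,
    ⟨rfl, fun i hi => ?_, ?_⟩, fun i => rfl, rfl⟩
  · simpa using hp.irrational
  · obtain ⟨i, rfl⟩ := Nat.exists_eq_succ_of_ne_zero hi.ne'
    exact hu i
  · simpa [codedQuotients] using tendsto_finiteCF_cons hp

/-- Existence of a coded real makes the `epsilon` choice meaningful, and injectivity of `hashCode`
identifies its partial quotients. -/
theorem isCFExpansion_codedReal {u : ℕ → List Bool} (hu : ∀ n, 0 < binVal (u n)) :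
    IsCFExpansion (codedQuotients u) (codedReal (hashCode u)) := by
  obtain ⟨_, _, _, a, u', ha, hau, hcode⟩ : IsHashCoding (hashCode u) (codedReal (hashCode u)) :=
    Classical.epsilon_spec (exists_isHashCoding hu)
  obtain rfl := hashCode_injective hcode
  have : a = codedQuotients u := by
    funext n
    rcases n with _ | n
    · exact ha.1
    · exact (hau n).symm
  exact this ▸ ha

end OstrowskiAddition

namespace OstrowskiAddition

/-! ### Addition of Ostrowski representations as a bounded linear recurrence -/

/-- The digit conditions for Ostrowski representations. -/
def OstrowskiDigits (a x : ℕ → ℕ) : Prop :=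
  x 0 < a 1 ∧ (∀ n, x n ≤ a (n + 1)) ∧ ∀ n, x (n + 1) = a (n + 2) → x n = 0

/-- If the top digit is not maximal, one spare copy of its denominator absorbs the lower sum. If it
is maximal, the digit below is zero and the bound two levels down applies. -/
theorem OstrowskiDigits.sum_lt {a x : ℕ → ℕ} (h : OstrowskiDigits a x) (n : ℕ) :
    ∑ i ∈ Finset.range n, x i * convDenom a i < convDenom a n := by
  induction n using Nat.twoStepInduction with
  | zero => simp [convDenom]
  | one => simpa [convDenom] using h.1
  | more n ih0 ih1 =>
    have hx := h.2.1 (n + 1)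
    rw [Finset.sum_range_succ, convDenom]
    rcases hx.lt_or_eq with hlt | heq
    · have : (x (n + 1) + 1) * convDenom a (n + 1) ≤ a (n + 2) * convDenom a (n + 1) :=
        Nat.mul_le_mul_right _ hlt
      linarith [Nat.zero_le (convDenom a n)]
    · rw [Finset.sum_range_succ, h.2.2 n heq, heq]
      linarith

theorem convDenom_pos {a : ℕ → ℕ} (ha : ∀ i, 0 < a (i + 1)) (n : ℕ) : 0 < convDenom a n := by
  induction n using Nat.twoStepInduction with
  | zero => simp [convDenom]
  | one => exact ha 0
  | more n ih0 ih1 => rw [convDenom]; positivity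

theorem convDenom_add_le {a : ℕ → ℕ} (ha : ∀ i, 0 < a (i + 1)) (n : ℕ) :
    convDenom a (n + 1) + convDenom a n ≤ convDenom a (n + 2) := by
  rw [convDenom]
  exact Nat.add_le_add_right (Nat.le_mul_of_pos_left _ (ha _)) _

theorem convDenom_le_succ {a : ℕ → ℕ} (ha : ∀ i, 0 < a (i + 1)) (n : ℕ) :
    convDenom a n ≤ convDenom a (n + 1) := by
  rcases n with _ | n
  · exact ha 0
  · exact le_trans (Nat.le_add_right _ _) (convDenom_add_le ha n)

theorem exists_backward_recurrence (m : ℕ) (a d : ℕ → ℤ) (hd : ∀ n, m ≤ n → d n = 0) :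
    ∃ r : ℕ → ℤ, (∀ n, m ≤ n → r n = 0) ∧
      ∀ n, r n = a (n + 1) * r (n + 1) + r (n + 2) + d n := by
  induction m generalizing a d with
  | zero => exact ⟨0, by simp, fun n => by simp [hd n]⟩
  | succ m ih =>
    obtain ⟨r, hr0, hr⟩ := ih (fun n => a (n + 1)) (fun n => d (n + 1))
      fun n hn => hd _ (by omega)
    refine ⟨fun n => match n with
      | 0 => a 1 * r 0 + r 1 + d 0
      | n + 1 => r n, fun n hn => ?_, fun n => ?_⟩
    · rcases n with _ | n
      · omega
      · exact hr0 n (by omega)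
    · rcases n with _ | n
      · rfl
      · exact hr n

/-- The recurrence of `r` is adjoint to that of the denominators, so the sum telescopes to boundary
terms. -/
theorem sum_mul_convDenom {a : ℕ → ℕ} {d r : ℕ → ℤ}
    (hr : ∀ n, r n = a (n + 1) * r (n + 1) + r (n + 2) + d n) (k : ℕ) :
    ∑ i ∈ Finset.range (k + 1), d i * convDenom a i =
      r 0 - r (k + 1) * convDenom a (k + 1) - r (k + 2) * convDenom a k := by
  induction k with
  | zero =>
    have := hr 0
    simp [convDenom]
    linarith
  | succ k ih =>
    rw [Finset.sum_range_succ, ih, convDenom.eq_3]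
    have := hr (k + 1)
    push_cast
    linear_combination -(convDenom a (k + 1) : ℤ) * this

/-- Downward induction in steps of two: a single step gains only the ratio `q_k / q_{k+1}`, which
may be close to 1, while `2 q_k ≤ q_{k+2}` always. The bound reproduces itself, as 8 = 2 + 2 + 8/2.
-/
theorem abs_le_eight_of_recurrence {a : ℕ → ℕ} (ha : ∀ i, 0 < a (i + 1)) {r : ℕ → ℤ} {m : ℕ}
    (h0 : r 0 = 0) (hm : ∀ n, m ≤ n → r n = 0)
    (hb : ∀ k, |r (k + 1) * convDenom a (k + 1) + r (k + 2) * convDenom a k| ≤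
      2 * convDenom a (k + 1)) (n : ℕ) : |r n| ≤ 8 := by
  have step : ∀ k, |r (k + 1)| * convDenom a (k + 1) ≤
      2 * convDenom a (k + 1) + |r (k + 2)| * convDenom a k := by
    intro k
    have h1 := abs_sub_abs_le_abs_add (r (k + 1) * convDenom a (k + 1))
      (r (k + 2) * convDenom a k)
    rw [abs_mul, abs_mul, Nat.abs_cast, Nat.abs_cast] at h1
    linarith [hb k]
  have key : ∀ j n, m ≤ n + j → |r n| ≤ 8 := by
    intro j
    induction j using Nat.twoStepInduction with
    | zero => intro n hn; simp [hm n (by omega)]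
    | one =>
      intro n hn
      rcases n with _ | k
      · simp [h0]
      have h1 := step k
      rw [hm (k + 2) (by omega)] at h1
      have hpos : (0 : ℤ) < convDenom a (k + 1) := by exact_mod_cast convDenom_pos ha (k + 1)
      simp only [abs_zero, zero_mul, add_zero] at h1
      linarith [le_of_mul_le_mul_right h1 hpos]
    | more j ih _ =>
      intro n hn
      rcases n with _ | k
      · simp [h0]
      have h1 := step k
      have h2 := step (k + 1)
      have h3 := ih (k + 3) (by omega)
      have hpos : (0 : ℤ) < convDenom a (k + 1) := by exact_mod_cast convDenom_pos ha (k + 1)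
      have hpos0 : (0 : ℤ) < convDenom a k := by exact_mod_cast convDenom_pos ha k
      have hpos2 : (0 : ℤ) < convDenom a (k + 2) := by exact_mod_cast convDenom_pos ha (k + 2)
      have hle : (convDenom a k : ℤ) ≤ convDenom a (k + 1) := by
        exact_mod_cast convDenom_le_succ ha k
      have hadd : (convDenom a (k + 1) + convDenom a k : ℤ) ≤ convDenom a (k + 2) := by
        exact_mod_cast convDenom_add_le ha k
      simp only [add_assoc, Nat.reduceAdd] at h1 h2 h3
      generalize (convDenom a k : ℤ) = q₀ at *
      generalize (convDenom a (k + 1) : ℤ) = q₁ at *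
      generalize (convDenom a (k + 2) : ℤ) = q₂ at *
      have h4 : |r (k + 2)| * q₂ ≤ 2 * q₂ + 8 * q₁ := by
        linarith [mul_le_mul_of_nonneg_right h3 hpos.le]
      have h5 : |r (k + 2)| * q₀ ≤ 6 * q₁ := by
        refine le_of_mul_le_mul_right ?_ hpos2
        calc |r (k + 2)| * q₀ * q₂ = |r (k + 2)| * q₂ * q₀ := by ring
          _ ≤ (2 * q₂ + 8 * q₁) * q₀ := mul_le_mul_of_nonneg_right h4 hpos0.le
          _ = 2 * (q₂ * q₀) + q₁ * (8 * q₀) := by ring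
          _ ≤ 2 * (q₂ * q₁) + q₁ * (4 * q₂) :=
            add_le_add
              (mul_le_mul_of_nonneg_left (mul_le_mul_of_nonneg_left hle hpos2.le) (by norm_num))
              (mul_le_mul_of_nonneg_left (by linarith) hpos.le)
          _ = 6 * q₁ * q₂ := by ring
      refine le_of_mul_le_mul_right ?_ hpos
      linarith
  exact key m n (by omega)

/-- The sum of two numbers given by Ostrowski digits is computed by a bounded recurrence. -/
theorem sum_add_eq_iff_exists_recurrence {a x y z : ℕ → ℕ} (ha : ∀ i, 0 < a (i + 1))
    (hx : OstrowskiDigits a x) (hy : OstrowskiDigits a y) (hz : OstrowskiDigits a z) {m : ℕ}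
    (hx0 : ∀ n, m ≤ n → x n = 0) (hy0 : ∀ n, m ≤ n → y n = 0) (hz0 : ∀ n, m ≤ n → z n = 0) :
    (∑ i ∈ Finset.range m, x i * convDenom a i) + ∑ i ∈ Finset.range m, y i * convDenom a i =
        ∑ i ∈ Finset.range m, z i * convDenom a i ↔
      ∃ r : ℕ → ℤ, (∀ n, |r n| ≤ 8) ∧ r 0 = 0 ∧ (∃ M, ∀ n, M ≤ n → r n = 0) ∧
        ∀ n, r n = a (n + 1) * r (n + 1) + r (n + 2) + ((z n : ℤ) - x n - y n) := by
  have hsum : ∀ k, ∑ i ∈ Finset.range k, ((z i : ℤ) - x i - y i) * convDenom a i =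
      (∑ i ∈ Finset.range k, z i * convDenom a i : ℕ) -
      (∑ i ∈ Finset.range k, x i * convDenom a i : ℕ) -
      (∑ i ∈ Finset.range k, y i * convDenom a i : ℕ) := by
    intro k
    push_cast
    rw [← Finset.sum_sub_distrib, ← Finset.sum_sub_distrib]
    exact Finset.sum_congr rfl fun i _ => by ring
  have hd0 : ∀ n, m ≤ n → (z n : ℤ) - x n - y n = 0 := fun n hn => by
    rw [hx0 n hn, hy0 n hn, hz0 n hn]; simp
  have hext : ∀ k, m ≤ k → ∑ i ∈ Finset.range k, ((z i : ℤ) - x i - y i) * convDenom a i =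
      ∑ i ∈ Finset.range m, ((z i : ℤ) - x i - y i) * convDenom a i := by
    intro k hk
    refine (Finset.sum_subset (Finset.range_mono hk) fun i _ hi => ?_).symm
    rw [hd0 i (by simpa using hi), zero_mul]
  have hval : ∀ r : ℕ → ℤ, (∃ M, ∀ n, M ≤ n → r n = 0) →
      (∀ n, r n = a (n + 1) * r (n + 1) + r (n + 2) + ((z n : ℤ) - x n - y n)) →
      ∑ i ∈ Finset.range m, ((z i : ℤ) - x i - y i) * convDenom a i = r 0 := by
    rintro r ⟨M, hM⟩ hr
    -- Beyond both `m` and `M` the boundary terms vanish.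
    rw [← hext (max m M + 1) (by omega), sum_mul_convDenom hr, hM _ (Nat.le_succ_of_le (le_max_right m M)),
      hM _ (Nat.le_succ_of_le (Nat.le_succ_of_le (le_max_right m M)))]
    ring
  have hiff : (∑ i ∈ Finset.range m, x i * convDenom a i) +
      ∑ i ∈ Finset.range m, y i * convDenom a i = ∑ i ∈ Finset.range m, z i * convDenom a i ↔
      ∑ i ∈ Finset.range m, ((z i : ℤ) - x i - y i) * convDenom a i = 0 := by
    rw [hsum]; omega
  rw [hiff]
  constructor
  · intro h
    obtain ⟨r, hr0, hr⟩ := exists_backward_recurrence m (fun n => a n)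
      (fun n => (z n : ℤ) - x n - y n) hd0
    have h0 : r 0 = 0 := by rw [← hval r ⟨m, hr0⟩ hr, h]
    refine ⟨r, abs_le_eight_of_recurrence ha h0 hr0 fun k => ?_, h0, ⟨m, hr0⟩, hr⟩
    have h1 := sum_mul_convDenom hr (k)
    rw [hsum, h0] at h1
    have h2 := Int.ofNat_lt.2 (hx.sum_lt (k + 1))
    have h3 := Int.ofNat_lt.2 (hy.sum_lt (k + 1))
    -- With q the next denominator, the truncated sum of z - x - y lies between -2q and q.
    have h4 := Int.ofNat_lt.2 (hz.sum_lt (k + 1))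
    have h5 := Int.natCast_nonneg (∑ i ∈ Finset.range (k + 1), x i * convDenom a i)
    have h6 := Int.natCast_nonneg (∑ i ∈ Finset.range (k + 1), y i * convDenom a i)
    have h7 := Int.natCast_nonneg (∑ i ∈ Finset.range (k + 1), z i * convDenom a i)
    rw [abs_le]
    constructor <;> linarith
  · rintro ⟨r, _, h0, hM, hr⟩
    rw [hval r hM hr, h0]

end OstrowskiAddition

namespace OstrowskiAddition

/-! ### The addition relation in terms of blocks -/

theorem binVal_pos_iff (l : List Bool) : 0 < binVal l ↔ true ∈ l := by
  induction l with
  | nil => simp [binVal]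
  | cons b l ih =>
    simp only [binVal, List.map_cons, Nat.ofDigits_cons, List.mem_cons] at ih ⊢
    rcases b with _ | _ <;> simp [← ih]

/-- Removes the real number: its expansion is unique, so the quotients are read off from `u`. The
bound `m` is exclusive, whereas `L` in `IsOstrowskiRep` is inclusive. -/
theorem isHashOstrowskiRep_iff {u b : ℕ → List Bool} (hu : ∀ n, 0 < binVal (u n)) {N : ℕ} :
    IsHashOstrowskiRep (hashCode u) (hashCode b) N ↔ (∀ n, (b n).length = (u n).length) ∧
      OstrowskiDigits (codedQuotients u) (fun n => binVal (b n)) ∧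
      ∃ m, (∀ n, m ≤ n → binVal (b n) = 0) ∧
        ∑ n ∈ Finset.range m, binVal (b n) * convDenom (codedQuotients u) n = N := by
  constructor
  · rintro ⟨hal, b', hb, a, ha, h1, h2, h3, L, hL, hN⟩
    obtain rfl := hashCode_injective hb
    obtain rfl := ha.unique (isCFExpansion_codedReal hu)
    exact ⟨fun n => (hal.length_eq n).symm, ⟨h1, h2, h3⟩, L + 1, fun n hn => hL n hn, hN.symm⟩
  · rintro ⟨hlen, ⟨h1, h2, h3⟩, m, hm, hN⟩
    refine ⟨Aligned.of_length_eq fun n => (hlen n).symm, b, rfl, codedQuotients u,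
      isCFExpansion_codedReal hu, h1, h2, h3, m, fun n hn => hm n hn.le, ?_⟩
    rw [Finset.sum_range_succ]
    simp only [hm m le_rfl, zero_mul, add_zero, hN]

theorem sum_range_mul_eq_of_le {x q : ℕ → ℕ} {m k : ℕ} (hx : ∀ n, m ≤ n → x n = 0)
    (h : m ≤ k) :
    ∑ n ∈ Finset.range k, x n * q n = ∑ n ∈ Finset.range m, x n * q n := by
  refine (Finset.sum_subset (Finset.range_mono h) fun i _ hi => ?_).symm
  rw [hx i (by simpa using hi), zero_mul]

/-- The `j`-th component of a block of 4-tuples of binary digits. -/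
def blockComponent (j : Fin 4) (l : List (Fin 4 → Bool)) : List Bool := l.map (· j)

theorem exists_blockComponent_eq (b : Fin 4 → ℕ → List Bool)
    (h : ∀ j n, (b j n).length = (b 0 n).length) :
    ∃ w : ℕ → List (Fin 4 → Bool), ∀ j, b j = fun n => blockComponent j (w n) := by
  refine ⟨fun n => List.ofFn fun (i : Fin (b 0 n).length) j =>
    (b j n)[i.1]'(i.2.trans_eq (h j n).symm), fun j => funext fun n => ?_⟩
  refine List.ext_getElem (by simp [blockComponent, h]) fun i h1 h2 => ?_
  simp [blockComponent]

/-- The blocks `w` code a tuple `(v, s₁, s₂, s₃)` of `oplusFin`. -/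
def IsAdditionBlocks (w : ℕ → List (Fin 4 → Bool)) : Prop :=
  (∀ n, 0 < binVal (blockComponent 0 (w n))) ∧
  (∀ j : Fin 3, OstrowskiDigits (codedQuotients fun n => blockComponent 0 (w n))
    fun n => binVal (blockComponent j.succ (w n))) ∧
  ∃ m, (∀ (j : Fin 3) n, m ≤ n → binVal (blockComponent j.succ (w n)) = 0) ∧
    ∃ r : ℕ → ℤ, (∀ n, |r n| ≤ 8) ∧ r 0 = 0 ∧ (∃ M, ∀ n, M ≤ n → r n = 0) ∧
      ∀ n, r n = binVal (blockComponent 0 (w n)) * r (n + 1) + r (n + 2) +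
        ((binVal (blockComponent 3 (w n)) : ℤ) - binVal (blockComponent 1 (w n)) -
          binVal (blockComponent 2 (w n)))

theorem mem_oplusFin_iff (t : Fin 4 → ℕ → HashSym) :
    t ∈ oplusFin ↔ ∃ w : ℕ → List (Fin 4 → Bool),
      (∀ j, t j = hashCode fun n => blockComponent j (w n)) ∧ IsAdditionBlocks w := by
  have iff_sum : ∀ (w : ℕ → List (Fin 4 → Bool)) (m : ℕ),
      (∀ n, 0 < binVal (blockComponent 0 (w n))) →
      (∀ j : Fin 3, OstrowskiDigits (codedQuotients fun n => blockComponent 0 (w n))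
        fun n => binVal (blockComponent j.succ (w n))) →
      (∀ (j : Fin 3) n, m ≤ n → binVal (blockComponent j.succ (w n)) = 0) → _ :=
    fun w m h0 hd hm => sum_add_eq_iff_exists_recurrence
      (a := codedQuotients fun n => blockComponent 0 (w n)) h0
      (hd 0) (hd 1) (hd 2) (hm 0) (hm 1) (hm 2)
  constructor
  · rintro ⟨⟨u, hu, hv⟩, hA₁, hA₂, hA₃, hsum⟩
    have hu' : ∀ n, 0 < binVal (u n) := fun n => (binVal_pos_iff _).2 (hu n)
    have hA : ∀ j : Fin 3, t j.succ ∈ AFin (t 0) := by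
      intro j
      fin_cases j
      exacts [hA₁, hA₂, hA₃]
    have hZ : ∀ j, IsHashOstrowskiRep (t 0) (t j.succ) (Z (t 0) ⟨t j.succ, hA j⟩) :=
      fun j => Classical.choose_spec (hA j)
    replace hsum : Z (t 0) ⟨t (Fin.succ 0), hA 0⟩ + Z (t 0) ⟨t (Fin.succ 1), hA 1⟩ =
      Z (t 0) ⟨t (Fin.succ 2), hA 2⟩ := hsum
    generalize hN : (fun j => Z (t 0) ⟨t j.succ, hA j⟩) = N at hsum
    have hb : ∀ j : Fin 3, ∃ b, t j.succ = hashCode b := fun j => by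
      obtain ⟨_, _, b, hb, _⟩ := hA j
      exact ⟨b, hb⟩
    choose b hb using hb
    have hrep : ∀ j, IsHashOstrowskiRep (hashCode u) (hashCode (b j)) (N j) := fun j => by
      rw [← hv, ← hb, ← hN]; exact hZ j
    replace hsum : N 0 + N 1 = N 2 := by rw [← hN]; exact hsum
    simp only [isHashOstrowskiRep_iff hu'] at hrep
    choose hlen hdig m hm hval using hrep
    obtain ⟨w, hw⟩ := exists_blockComponent_eq (Fin.cons u b) fun j n => by
      refine Fin.cases rfl (fun j => ?_) j
      exact hlen j n
    obtain rfl : u = _ := hw 0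
    have hw' : ∀ j : Fin 3, b j = fun n => blockComponent j.succ (w n) := fun j => hw j.succ
    simp only [hw'] at hdig hm hval
    have hm' : ∀ (j : Fin 3) n, m 0 + m 1 + m 2 ≤ n →
        binVal (blockComponent j.succ (w n)) = 0 := by
      intro j n hn
      refine hm j n ?_
      fin_cases j <;> simp <;> omega
    refine ⟨w, fun j => ?_, hu', hdig, m 0 + m 1 + m 2, hm', ?_⟩
    · refine Fin.cases hv (fun j => ?_) j
      rw [hb, hw']
    · refine (iff_sum w _ hu' hdig hm').1 ?_
      rw [sum_range_mul_eq_of_le (hm 0) (by omega), sum_range_mul_eq_of_le (hm 1) (by omega),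
        sum_range_mul_eq_of_le (hm 2) (by omega), hval, hval, hval, hsum]
  · rintro ⟨w, ht, h0, hd, m, hm, hr⟩
    have hsum := (iff_sum w m h0 hd hm).2 hr
    have hlen : ∀ (j : Fin 3) n,
        (blockComponent j.succ (w n)).length = (blockComponent 0 (w n)).length := by
      simp [blockComponent]
    have hA : ∀ j : Fin 3, t j.succ ∈ AFin (t 0) := fun j => by
      rw [ht, ht]
      exact ⟨_, (isHashOstrowskiRep_iff h0).2 ⟨hlen j, hd j, m, hm j, rfl⟩⟩
    have hZ : ∀ j : Fin 3, Z (t 0) ⟨t j.succ, hA j⟩ = ∑ n ∈ Finset.range m,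
        binVal (blockComponent j.succ (w n)) *
          convDenom (codedQuotients fun n => blockComponent 0 (w n)) n := by
      intro j
      -- Whatever value `Z` chose, it is a truncated digit sum, and truncations past the support
      -- agree.
      have h := Classical.choose_spec (hA j)
      rw [← Z.eq_1 (t 0) ⟨t j.succ, hA j⟩] at h
      generalize Z (t 0) ⟨t j.succ, hA j⟩ = N at h ⊢
      rw [ht, ht, isHashOstrowskiRep_iff h0] at h
      obtain ⟨_, _, k, hk, hN⟩ := h
      rw [← hN, ← sum_range_mul_eq_of_le hk (le_max_left k m),
        sum_range_mul_eq_of_le (hm j) (le_max_right k m)]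
    refine ⟨⟨_, fun n => (binVal_pos_iff _).1 (h0 n), ht 0⟩, hA 0, hA 1, hA 2, ?_⟩
    exact (congrArg₂ (· + ·) (hZ 0) (hZ 1)).trans (hsum.trans (hZ 2).symm)

/-! ### The automaton for addition -/

/-- The states between blocks: the values `rₙ` and `rₙ₊₁` of the recurrence, for each summand
whether its previous digit may be nonzero, and whether all later digits and values vanish. -/
abbrev AdditionState : Type :=
  Set.Icc (-8 : ℤ) 8 × Set.Icc (-8 : ℤ) 8 × (Fin 3 → Prop) × Prop

/-- The number with binary digits in the `j`-th component of a block. -/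
def blockVal (j : Fin 4) (l : List (Fin 4 → Bool)) : ℤ := weight (fun b => ((b j).toNat : ℤ)) l

theorem blockVal_eq (j : Fin 4) (l : List (Fin 4 → Bool)) :
    blockVal j l = binVal (blockComponent j l) :=
  weight_map_toNat (fun b : Fin 4 → Bool => b j) l

/-- The condition on a block for passing from state `p` to state `p'`. -/
def AdditionStep (p p' : AdditionState) (l : List (Fin 4 → Bool)) : Prop :=
  p.2.1 = p'.1 ∧ 0 < blockVal 0 l ∧
  (∀ j : Fin 3, ¬ blockVal 0 l < blockVal j.succ l) ∧
  (∀ j : Fin 3, blockVal j.succ l = blockVal 0 l → ¬ p.2.2.1 j) ∧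
  -- One implication suffices: a flag raised without need only makes the next block harder to
  -- accept.
  (∀ j : Fin 3, ¬ blockVal j.succ l = 0 → p'.2.2.1 j) ∧
  ((p.1 : ℤ) = blockVal 0 l * p.2.1 + p'.2.1 + (blockVal 3 l - blockVal 1 l - blockVal 2 l)) ∧
  (p.2.2.2 → p'.2.2.2 ∧ (p.1 : ℤ) = 0 ∧ ∀ j : Fin 3, blockVal j.succ l = 0)

theorem isRegular_additionStep (p p' : AdditionState) :
    Language.IsRegular {l | AdditionStep p p' l} := by
  have hpos : Language.IsRegular {l | 0 < blockVal 0 l} := isRegular_lt_weight _ 0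
  have hlt : ∀ j : Fin 3, Language.IsRegular {l | blockVal 0 l < blockVal j.succ l} := by
    intro j
    have h := isRegular_lt_weight
      (fun b : Fin 4 → Bool => ((b j.succ).toNat : ℤ) - (b 0).toNat) 0
    simpa only [weight_sub, sub_pos, blockVal] using h
  have heq : ∀ j : Fin 3, Language.IsRegular {l | blockVal j.succ l = blockVal 0 l} := by
    intro j
    have h := isRegular_weight_eq
      (fun b : Fin 4 → Bool => ((b j.succ).toNat : ℤ) - (b 0).toNat) 0
    simpa only [weight_sub, sub_eq_zero, blockVal] using h
  have hzero : ∀ j : Fin 3, Language.IsRegular {l | blockVal j.succ l = 0} := fun j =>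
    isRegular_weight_eq _ 0
  have hlin : Language.IsRegular {l | (p.1 : ℤ) = blockVal 0 l * p.2.1 + p'.2.1 +
      (blockVal 3 l - blockVal 1 l - blockVal 2 l)} := by
    -- The product of quotient and carry is linear in the block, because the carry `p.2.1` is fixed
    -- by the state.
    have h := isRegular_weight_eq (fun b : Fin 4 → Bool => (p.2.1 : ℤ) * ((b 0).toNat : ℤ) +
      (((b 3).toNat : ℤ) - (b 1).toNat - (b 2).toNat)) (p.1 - p'.2.1)
    simp only [weight_add, weight_sub, weight_mul] at h
    refine (congrArg Language.IsRegular (Set.ext fun l => ?_)).mp h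
    simp only [blockVal]
    constructor <;> intro (h : _ = _) <;> change _ = _ <;> linarith
  exact isRegular_and (isRegular_const _) <| isRegular_and hpos <|
    isRegular_and (isRegular_forall fun j => isRegular_not (hlt j)) <|
    isRegular_and (isRegular_forall fun j => isRegular_imp (heq j) (isRegular_const _)) <|
    isRegular_and
      (isRegular_forall fun j => isRegular_imp (isRegular_not (hzero j)) (isRegular_const _)) <|
    isRegular_and hlin <| isRegular_imp (isRegular_const _) <|
    isRegular_and (isRegular_const _) <| isRegular_and (isRegular_const _) <|
    isRegular_forall hzero

theorem isAdditionBlocks_iff (w : ℕ → List (Fin 4 → Bool)) :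
    IsAdditionBlocks w ↔ ∃ p : ℕ → AdditionState,
      p 0 ∈ {p : AdditionState | (p.1 : ℤ) = 0 ∧ ∀ j, p.2.2.1 j} ∧
      (∀ n, AdditionStep (p n) (p (n + 1)) (w n)) ∧
      {n | p n ∈ {p : AdditionState | p.2.2.2}}.Infinite := by
  constructor
  · rintro ⟨hpos, hdig, m, hm, r, hr8, hr0, ⟨M, hM⟩, hr⟩
    refine ⟨fun n => (⟨r n, abs_le.1 (hr8 n)⟩, ⟨r (n + 1), abs_le.1 (hr8 _)⟩,
      -- Raising every flag at `n = 0` forbids a maximal first digit, which is the strict condition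
      -- `x 0 < a 1`.
      fun j => n = 0 ∨ binVal (blockComponent j.succ (w (n - 1))) ≠ 0, m + M ≤ n),
      ⟨hr0, fun j => Or.inl rfl⟩, fun n => ⟨rfl, ?_, fun j => ?_, fun j h => ?_, fun j h => ?_,
        ?_, fun h => ⟨Nat.le_succ_of_le h, hM n (by omega), fun j => ?_⟩⟩, ?_⟩
    · rw [blockVal_eq]; exact_mod_cast hpos n
    · rw [blockVal_eq, blockVal_eq]; exact_mod_cast (not_lt.2 ((hdig j).2.1 n))
    · rw [blockVal_eq, blockVal_eq, Nat.cast_inj] at h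
      rcases n with _ | n
      · exact absurd h (hdig j).1.ne
      · simpa using (hdig j).2.2 n h
    · rw [blockVal_eq] at h
      exact Or.inr (by exact_mod_cast h)
    · simp only [blockVal_eq]
      exact hr n
    · rw [blockVal_eq, hm j n (by omega)]; rfl
    · exact (Set.Ici_infinite (m + M)).mono fun n hn => hn
  · rintro ⟨p, ⟨hp0, hpnz⟩, hstep, hinf⟩
    -- The final flag persists once raised, so a single accepting visit gives a zero tail.
    have htail : ∃ m, ∀ n, m ≤ n → (p n).2.2.2 := by
      obtain ⟨m, hm⟩ := hinf.nonempty
      refine ⟨m, fun n hn => ?_⟩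
      induction n, hn using Nat.le_induction with
      | base => exact hm
      | succ n _ ih => exact ((hstep n).2.2.2.2.2.2 ih).1
    obtain ⟨m, hm⟩ := htail
    simp only [AdditionStep, blockVal_eq] at hstep
    have hnext : ∀ n, (p n).2.1 = (p (n + 1)).1 := fun n => (hstep n).1
    refine ⟨fun n => by exact_mod_cast (hstep n).2.1, fun j => ⟨?_, fun n => ?_, fun n h => ?_⟩,
      m, fun j n hn => ?_, fun n => (p n).1, fun n => abs_le.2 (p n).1.2, hp0,
      ⟨m, fun n hn => ((hstep n).2.2.2.2.2.2 (hm n hn)).2.1⟩, fun n => ?_⟩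
    · have h1 := (hstep 0).2.2.1 j
      have h2 := (hstep 0).2.2.2.1 j
      refine lt_of_le_of_ne (by exact_mod_cast not_lt.1 h1) fun h => ?_
      exact h2 (by exact_mod_cast h) (hpnz j)
    · exact_mod_cast not_lt.1 ((hstep n).2.2.1 j)
    · by_contra hne
      refine (hstep (n + 1)).2.2.2.1 j (by exact_mod_cast h) ?_
      exact (hstep n).2.2.2.2.1 j (by exact_mod_cast hne)
    · exact_mod_cast ((hstep n).2.2.2.2.2.2 (hm n hn)).2.2 j
    · have h := (hstep n).2.2.2.2.2.1
      rw [hnext n, hnext (n + 1)] at h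
      exact h

/-- The letter of the convolution of four aligned words with a given common letter. -/
def jointLetter (c : Option (Fin 4 → Bool)) : Fin 4 → HashSym := fun j => c.map (· j)

theorem convolution_eq_iff {W : ℕ → Option (Fin 4 → Bool)} {w : ℕ → List (Fin 4 → Bool)}
    (hW : IsBlockCode W w) (t : Fin 4 → ℕ → HashSym) :
    (fun i => jointLetter (W i)) = convolution t ↔
      ∀ j, t j = hashCode fun n => blockComponent j (w n) := by
  have h : ∀ j, (hashCode fun n => blockComponent j (w n)) = fun i => jointLetter (W i) j :=
    fun j => (hW.map fun b : Fin 4 → Bool => b j).eq_hashCode.symm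
  simp only [h, funext_iff, convolution]
  exact ⟨fun h j i => (h i j).symm, fun h i j => (h j i).symm⟩

end OstrowskiAddition

/-! ### The addition relation is ω-regular -/

open OstrowskiAddition in
theorem mainTheorem4 : OstrowskiAddition.IsOmegaRegularRel OstrowskiAddition.oplusFin := by
  have h := (isOmegaRegular_blocks (fun p p' => {l | AdditionStep p p' l}) isRegular_additionStep
    {p : AdditionState | (p.1 : ℤ) = 0 ∧ ∀ j, p.2.2.1 j}
    {p : AdditionState | p.2.2.2}).image jointLetter
  rw [IsOmegaRegularRel]
  convert h using 1
  ext V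
  constructor
  · rintro ⟨t, ht, rfl⟩
    obtain ⟨w, hw, hadd⟩ := (mem_oplusFin_iff t).1 ht
    obtain ⟨p, hp⟩ := (isAdditionBlocks_iff w).1 hadd
    obtain ⟨W, hW⟩ := exists_isBlockCode w
    exact ⟨W, ⟨w, p, hW, hp⟩, (convolution_eq_iff hW t).2 hw⟩
  · rintro ⟨W, ⟨w, p, hW, hp⟩, rfl⟩
    have e := (convolution_eq_iff hW fun j i => jointLetter (W i) j).1 rfl
    exact ⟨_, (mem_oplusFin_iff _).2 ⟨w, e, (isAdditionBlocks_iff w).2 ⟨p, hp⟩⟩, rfl⟩
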